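/- Let $\mathcal A$ be a hereditary abelian category, that is, an abelian category with $\operatorname{Ext}^n_{\mathcal A}(-,-)=0$ for all $n>1$, and let $\mathbf D(\mathcal A)$ be its unbounded derived category. Let $\mathcal X$ be a full subcategory of $\mathcal A$ closed under isomorphisms, and let $\mathbf D_{\mathcal X}(\mathcal A)\subseteq\mathbf D(\mathcal A)$ be the full subcategory of complexes $K$ with $H^nK\in\mathcal X$ for all $n\in\mathbb Z$. Then the following are equivalent. (1) There exists a localization functor $L\colon\mathbf D(\mathcal A)\to\mathbf D(\mathcal A)$ with $\operatorname{Ker}L=\mathbf D_{\mathcal X}(\mathcal A)$; that is, there is an exact functor $L$ that admits a natural transformation $\eta\colon\operatorname{Id}\to L$ such that $L\eta_K$ is an isomorphism and $L\eta_K=\eta_{LK}$ for every $K\in\mathbf D(\mathcal A)$, and such that $LK=0$ if and only if $K\in\mathbf D_{\mathcal X}(\mathcal A)$. (2) There exists a full subcategory $\mathcal Y$ of $\mathcal A$ such that $(\mathcal X,\mathcal Y)$ is a complete Ext-orthogonal pair for $\mathcal A$; that is, $$\mathcal Y=\{N\in\mathcal A\mid \operatorname{Ext}^n_{\mathcal A}(X,N)=0\text{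 for all }X\in\mathcal X,\ n\ge 0\},\qquad \mathcal X=\{M\in\mathcal A\mid \operatorname{Ext}^n_{\mathcal A}(M,Y)=0\text{ for all }Y\in\mathcal Y,\ n\ge 0\},$$ and for every object $M\in\mathcal A$ there is an exact sequence $$0\to Y_M\to X_M\to M\to Y^M\to X^M\to 0$$ in $\mathcal A$ with $X_M,X^M\in\mathcal X$ and $Y_M,Y^M\in\mathcal Y$. -/

import Mathlib

universe w' w v u

open CategoryTheory CategoryTheory.Limits

namespace ExtOrthogonal

section Abelian

variable {A : Type u} [Category.{v} A] [Abelian A] [HasExt.{w'} A]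

variable (A) in
/-- An abelian category is hereditary if `Ext^n` vanishes identically for all `n > 1`. -/
def IsHereditary : Prop :=
  ∀ (M N : A) (n : ℕ), 1 < n → Subsingleton (Abelian.Ext.{w'} M N n)

/-- `Ext^*(M, N) = 0`, i.e. `Ext^n(M, N) = 0` for all `n` (the groups in negative degrees
vanish in an abelian category, so only natural numbers `n` matter). -/
def ExtVanish (M N : A) : Prop :=
  ∀ n : ℕ, Subsingleton (Abelian.Ext.{w'} M N n)

/-- The right orthogonal `C^⊥` with respect to `Ext^*`. -/
def rightPerp (C : ObjectProperty A) : ObjectProperty A :=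
  fun N => ∀ M : A, C M → ExtVanish.{w'} M N

/-- The left orthogonal `^⊥C` with respect to `Ext^*`. -/
def leftPerp (C : ObjectProperty A) : ObjectProperty A :=
  fun M => ∀ N : A, C N → ExtVanish.{w'} M N

/-- `(X, Y)` is an Ext-orthogonal pair: `X^⊥ = Y` and `X = ^⊥Y`. -/
structure IsExtOrthogonalPair (X Y : ObjectProperty A) : Prop where
  right_eq : rightPerp.{w'} X = Y
  left_eq : X = leftPerp.{w'} Y

/-- There is an exact sequence `0 → Y₁ → X₁ → M → Y₂ → X₂ → 0` with `X₁, X₂` in `X` and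
`Y₁, Y₂` in `Y`. -/
def HasApproximationSequence {A : Type u} [Category.{v} A] [Abelian A]
    (X Y : ObjectProperty A) (M : A) : Prop :=
  ∃ (Y₁ X₁ Y₂ X₂ : A) (a : Y₁ ⟶ X₁) (b : X₁ ⟶ M) (c : M ⟶ Y₂) (d : Y₂ ⟶ X₂)
    (hab : a ≫ b = 0) (hbc : b ≫ c = 0) (hcd : c ≫ d = 0),
    X X₁ ∧ X X₂ ∧ Y Y₁ ∧ Y Y₂ ∧
    Mono a ∧ (ShortComplex.mk a b hab).Exact ∧ (ShortComplex.mk b c hbc).Exact ∧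
    (ShortComplex.mk c d hcd).Exact ∧ Epi d

/-- A complete Ext-orthogonal pair: every object admits a five-term approximation sequence. -/
structure IsCompleteExtOrthogonalPair (X Y : ObjectProperty A) : Prop
    extends IsExtOrthogonalPair.{w'} X Y where
  complete : ∀ M : A, HasApproximationSequence X Y M

end Abelian

/-- The full subcategory `D_X(A)` of the (unbounded) derived category of `A` formed by the
complexes all of whose cohomology objects belong to `X`. -/
def derivedOf {A : Type u} [Category.{v} A] [Abelian A] [HasDerivedCategory.{w} A]
    (X : ObjectProperty A) : ObjectProperty (DerivedCategory A) :=
  fun K => ∀ n : ℤ, X ((DerivedCategory.homologyFunctor A n).obj K)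

/-- A localization functor on a triangulated category: an exact endofunctor `L` (the isomorphisms
`L(K[n]) ≅ (L K)[n]` being the given `CommShift` structure) that admits a natural transformation
`η : Id ⟶ L` such that `L η_K` is an isomorphism and `L η_K = η_{L K}` for every object `K`. -/
def IsLocalizationFunctor {T : Type u} [Category.{v} T] [HasZeroObject T] [HasShift T ℤ]
    [Preadditive T] [∀ n : ℤ, (shiftFunctor T n).Additive] [Pretriangulated T]
    (L : T ⥤ T) [L.CommShift ℤ] : Prop :=
  L.IsTriangulated ∧ ∃ η : 𝟭 T ⟶ L,
    (∀ K : T, IsIso (L.map (η.app K))) ∧ ∀ K : T, L.map (η.app K) = η.app (L.obj K)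

end ExtOrthogonal

/-! Localization functors with kernel a triangulated subcategory `P` amount to triangles `G → K → L
→ G[1]` with `G` in `P` and `L` in the right orthogonal of `P`, so both directions compare such
triangles for `D_X` with five-term sequences.

Heredity enters through formality: every complex is isomorphic in `D(A)` to its cohomology with zero
differentials (`IsHereditary.nonempty_iso_zeroDiff`). Hence orthogonality in `D(A)` can be tested on
cohomology objects (`IsHereditary.hom_eq_zero_of_extVanish`, `IsHereditary.rightPerp_homology`).

(1) ⇒ (2): the long exact cohomology sequence of the triangle of `M` in degree `0` is the five-term
sequence, and a kernel is closed under retracts, which gives `X = ^⊥(X^⊥)`.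

(2) ⇒ (1): the five-term sequences of all `H^n K`, taken together as complexes with zero
differentials, are spliced into a triangle for `K`. -/

namespace ExtOrthogonal

open Pretriangulated

/-! ### Localization functors and localization triangles -/

section Triangulated

variable {T : Type u} [Category.{v} T] [HasZeroObject T] [HasShift T ℤ]
    [Preadditive T] [∀ n : ℤ, (shiftFunctor T n).Additive] [Pretriangulated T]

/-- Every object is the middle term of a distinguished triangle whose outer terms belong to
`P` and to the right orthogonal of `P`. -/
def HasLocalizationTriangles (P : ObjectProperty T) : Prop :=
  ∀ K : T, ∃ (G L : T) (f : G ⟶ K) (g : K ⟶ L) (h : L ⟶ G⟦(1 : ℤ)⟧),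
    Triangle.mk f g h ∈ distTriang T ∧ P G ∧ P.rightOrthogonal L

/-- The triangle is the one completing `η_K`: its fibre is killed by `L` because `L η_K` is
invertible. -/
lemma IsLocalizationFunctor.hasLocalizationTriangles {L : T ⥤ T} [L.CommShift ℤ]
    (hL : IsLocalizationFunctor L) : HasLocalizationTriangles L.kernel := by
  obtain ⟨_, η, hη, hη'⟩ := hL
  intro K
  obtain ⟨G, f, h, hT⟩ := distinguished_cocone_triangle₁ (η.app K)
  refine ⟨G, _, f, η.app K, h, hT, ?_, ?_⟩
  · have := hη K
    have := L.map_distinguished _ hT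
    exact (Triangle.isZero₁_iff_isIso₂ _ this).2 (hη K)
  · intro Z φ hZ
    -- Naturality reads `φ ≫ η_{LK} = η_Z ≫ L φ = 0`, and `η_{LK} = L η_K` is invertible.
    have h₁ := η.naturality φ
    have : L.map φ = 0 := IsZero.eq_of_src hZ _ _
    have h₂ : IsIso (η.app (L.obj K)) := hη' K ▸ hη K
    rw [this, comp_zero] at h₁
    exact (cancel_mono (η.app (L.obj K))).1 (by simpa using h₁)

variable {P : ObjectProperty T}

/-- Each `g : K ⟶ L` has its fibre in `P`, so maps into right orthogonal objects extend uniquely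
along it. The universal property makes `K ↦ L` functorial. -/
lemma HasLocalizationTriangles.isRightAdjoint_ι (hP : HasLocalizationTriangles P)
    [P.IsTriangulated] : P.rightOrthogonal.ι.IsRightAdjoint := by
  choose G L f g h hT hG hL using hP
  let F : T → P.rightOrthogonal.FullSubcategory := fun K ↦ ⟨L K, hL K⟩
  have bij (K : T) (Y : P.rightOrthogonal.FullSubcategory) :
      Function.Bijective (fun φ : F K ⟶ Y ↦ g K ≫ φ.hom) := by
    have hg := (ObjectProperty.isLocal_trW P).symm.le _ Y.2 (g K)
      (ObjectProperty.trW.mk' P (hT K) (hG K))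
    refine ⟨fun a b hab ↦ ?_, fun b ↦ ?_⟩
    · ext
      exact hg.1 hab
    · obtain ⟨a, ha⟩ := hg.2 b
      exact ⟨⟨a⟩, ha⟩
  exact (Adjunction.adjunctionOfEquivLeft (G := P.rightOrthogonal.ι)
    (fun K Y ↦ Equiv.ofBijective _ (bij K Y)) (fun K Y Y' a b ↦ by simp)).isRightAdjoint

lemma kernel_of_adj_ι [P.IsTriangulated] [P.IsClosedUnderIsomorphisms]
    (hP : HasLocalizationTriangles P) {F : T ⥤ P.rightOrthogonal.FullSubcategory}
    (adj : F ⊣ P.rightOrthogonal.ι) :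
    (F ⋙ P.rightOrthogonal.ι).kernel = P := by
  ext K
  constructor
  · intro hK
    obtain ⟨G, L, f, g, h, hT, hG, hL⟩ := hP K
    have hg : g = 0 := by
      obtain ⟨a, rfl⟩ := (adj.homEquiv K ⟨L, hL⟩).surjective g
      have : a = 0 := by
        ext
        exact IsZero.eq_of_src hK _ _
      rw [this, adj.homEquiv_unit]
      simp
    have hs := ObjectProperty.trW.mk' P hT hG
    have hid := ((ObjectProperty.isLocal_trW P).symm.le _ hL g hs).1
      (a₁ := 𝟙 L) (a₂ := 0) (by simp [hg])
    have hz : IsZero L := (IsZero.iff_id_eq_zero _).2 hid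
    have : IsIso f := (Triangle.isZero₃_iff_isIso₁ _ hT).1 hz
    exact P.prop_of_iso (asIso f) hG
  · intro hK
    refine (IsZero.iff_id_eq_zero _).2 ?_
    have h0 : 𝟙 (F.obj K) = 0 := (adj.homEquiv _ _).injective (by
      rw [(F.obj K).property (adj.homEquiv K (F.obj K) (𝟙 _)) hK,
        (F.obj K).property (adj.homEquiv K (F.obj K) 0) hK])
    exact congrArg (fun φ ↦ φ.hom) h0

lemma HasLocalizationTriangles.exists_localizationFunctor [P.IsTriangulated]
    [P.IsClosedUnderIsomorphisms] (hP : HasLocalizationTriangles P) :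
    ∃ (L : T ⥤ T) (_ : L.CommShift ℤ), IsLocalizationFunctor L ∧ L.kernel = P := by
  have := hP.isRightAdjoint_ι
  let ι := P.rightOrthogonal.ι
  let F := ι.leftAdjoint
  let adj : F ⊣ ι := Adjunction.ofIsRightAdjoint ι
  let _ : F.CommShift ℤ := adj.leftAdjointCommShift ℤ
  have : adj.CommShift ℤ := adj.commShift_of_rightAdjoint ℤ
  have : F.IsTriangulated := adj.isTriangulated_leftAdjoint
  refine ⟨F ⋙ ι, inferInstance, ⟨inferInstance, adj.unit, fun K ↦ ?_, fun K ↦ ?_⟩,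
    kernel_of_adj_ι hP adj⟩
  · have : IsIso (F.map (adj.unit.app K)) := inferInstance
    exact inferInstanceAs (IsIso (ι.map (F.map (adj.unit.app K))))
  · have h₁ := adj.left_triangle_components K
    have h₂ := adj.right_triangle_components (F.obj K)
    rw [← cancel_mono (ι.map (adj.counit.app (F.obj K)))]
    refine Eq.trans ?_ h₂.symm
    exact (ι.map_comp _ _).symm.trans ((congrArg ι.map h₁).trans (ι.map_id _))

end Triangulated

/-! ### Lifting extensions along epimorphisms -/

section Lifting

variable {A : Type u} [Category.{v} A] [Abelian A]

lemma shortExact_homology_of_distinguished_single [HasDerivedCategory.{w} A] {P H : A}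
    {Z : DerivedCategory A} (f : (DerivedCategory.singleFunctor A 0).obj P ⟶ Z)
    (g : Z ⟶ (DerivedCategory.singleFunctor A 0).obj H)
    (h : (DerivedCategory.singleFunctor A 0).obj H ⟶
      ((DerivedCategory.singleFunctor A 0).obj P)⟦(1 : ℤ)⟧)
    (hT : Triangle.mk f g h ∈ distTriang (DerivedCategory A)) :
    (ShortComplex.mk ((DerivedCategory.homologyFunctor A 0).map f)
      ((DerivedCategory.homologyFunctor A 0).map g)
      (by rw [← Functor.map_comp, show f ≫ g = 0 from comp_distTriang_mor_zero₁₂ _ hT,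
        Functor.map_zero])).ShortExact where
  exact := DerivedCategory.HomologySequence.exact₂ _ hT 0
  mono_f := (DerivedCategory.HomologySequence.mono_homologyMap_mor₁_iff _ hT (-1) 0).2
    ((DerivedCategory.isZero_of_isGE ((DerivedCategory.singleFunctor A 0).obj H) 0 (-1)
      (by lia)).eq_of_src _ _)
  epi_g := (DerivedCategory.HomologySequence.epi_homologyMap_mor₂_iff _ hT 0 1).2
    ((DerivedCategory.isZero_of_isLE ((DerivedCategory.singleFunctor A 0).obj P) 0 1
      (by lia)).eq_of_tgt _ _)

/-- The homology in degree `0` of an object placed in degree `0`. -/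
noncomputable def homologySingleIso [HasDerivedCategory.{w} A] (M : A) :
    (DerivedCategory.homologyFunctor A 0).obj ((DerivedCategory.singleFunctor A 0).obj M) ≅ M :=
  (DerivedCategory.singleFunctorCompHomologyFunctorIso A 0).app M

@[simp]
lemma homologySingleIso_hom_naturality [HasDerivedCategory.{w} A] {M N : A} (f : M ⟶ N) :
    (DerivedCategory.homologyFunctor A 0).map ((DerivedCategory.singleFunctor A 0).map f) ≫
      (homologySingleIso N).hom = (homologySingleIso M).hom ≫ f :=
  (DerivedCategory.singleFunctorCompHomologyFunctorIso A 0).hom.naturality f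

/-- The triangle on `e` represents the extension. The hypothesis `he` says that `p` and the identity
of `S.X₃` commute with the connecting maps, so they complete to a morphism of triangles, and `H^0`
brings it back to `A`. -/
lemma exists_shortExact_map_of_ext [HasExt.{w'} A] {S : ShortComplex A} (hS : S.ShortExact)
    {P : A} (p : P ⟶ S.X₁) (e : Abelian.Ext.{w'} S.X₃ P 1)
    (he : e.comp (Abelian.Ext.mk₀ p) (add_zero 1) = hS.extClass) :
    ∃ (E : A) (i : P ⟶ E) (π : E ⟶ S.X₃) (t : E ⟶ S.X₂) (w : i ≫ π = 0),
      (ShortComplex.mk i π w).ShortExact ∧ i ≫ t = p ≫ S.f ∧ t ≫ S.g = π := by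
  let _ := HasDerivedCategory.standard A
  obtain ⟨Z, f, g, hT⟩ := distinguished_cocone_triangle₂
    (X := (DerivedCategory.singleFunctor A 0).obj P) (e.hom)
  have comm : e.hom ≫ ((DerivedCategory.singleFunctor A 0).map p)⟦(1 : ℤ)⟧' = hS.singleδ := by
    rw [← hS.extClass_hom, ← he]
    exact Abelian.Ext.hom_comp_singleFunctor_map_shift e p
  obtain ⟨b, hb₁, hb₂⟩ : ∃ b : Z ⟶ (DerivedCategory.singleFunctor A 0).obj S.X₂,
      f ≫ b = (DerivedCategory.singleFunctor A 0).map p ≫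
        (DerivedCategory.singleFunctor A 0).map S.f ∧
      g ≫ 𝟙 _ = b ≫ (DerivedCategory.singleFunctor A 0).map S.g :=
    complete_distinguished_triangle_morphism₂ _ _ hT hS.singleTriangle_distinguished
      ((DerivedCategory.singleFunctor A 0).map p) (𝟙 _) (comm.trans (Category.id_comp _).symm)
  have hSE := shortExact_homology_of_distinguished_single f g _ hT
  have w : (DerivedCategory.homologyFunctor A 0).map f ≫
      (DerivedCategory.homologyFunctor A 0).map g = 0 :=
    (by rw [← Functor.map_comp, show f ≫ g = 0 from comp_distTriang_mor_zero₁₂ _ hT,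
      Functor.map_zero])
  refine ⟨(DerivedCategory.homologyFunctor A 0).obj Z,
    (homologySingleIso P).inv ≫ (DerivedCategory.homologyFunctor A 0).map f,
    (DerivedCategory.homologyFunctor A 0).map g ≫ (homologySingleIso _).hom,
    (DerivedCategory.homologyFunctor A 0).map b ≫ (homologySingleIso _).hom,
    by simp [reassoc_of% w], ?_, ?_, ?_⟩
  · exact ShortComplex.shortExact_of_iso
      (ShortComplex.isoMk (S₁ := ShortComplex.mk _ _ w) (homologySingleIso P) (Iso.refl _)
        (homologySingleIso _) (by simp) (by simp)) hSE
  · rw [Category.assoc, ← Functor.map_comp_assoc, hb₁]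
    simp [reassoc_of% homologySingleIso_hom_naturality p]
  · rw [Category.assoc, ← homologySingleIso_hom_naturality, ← Functor.map_comp_assoc, ← hb₂,
      Category.comp_id]

/-- The obstruction to lifting the class of `0 → ker q → Z → H → 0` along the epimorphism `P → ker
q` lies in `Ext^2` of `H` with the kernel of that epimorphism, which vanishes. -/
lemma IsHereditary.exists_extension [HasExt.{w'} A] (hA : IsHereditary.{w'} A) {P Z H : A}
    (p : P ⟶ Z) (q : Z ⟶ H) (w : p ≫ q = 0) (ex : (ShortComplex.mk p q w).Exact) [Epi q] :
    ∃ (E : A) (i : P ⟶ E) (π : E ⟶ H) (t : E ⟶ Z) (w' : i ≫ π = 0),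
      (ShortComplex.mk i π w').ShortExact ∧ i ≫ t = p ∧ t ≫ q = π := by
  have hS₁ : (ShortComplex.mk (kernel.ι q) q (kernel.condition q)).ShortExact :=
    { exact := ShortComplex.exact_of_f_is_kernel _ (kernelIsKernel q) }
  have := ex.epi_kernelLift
  dsimp at this
  have hS₂ : (ShortComplex.mk (kernel.ι (kernel.lift q p w)) (kernel.lift q p w)
      (kernel.condition _)).ShortExact :=
    { exact := ShortComplex.exact_of_f_is_kernel _ (kernelIsKernel _) }
  obtain ⟨e, he⟩ := Abelian.Ext.covariant_sequence_exact₃ H hS₂ hS₁.extClass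
    (n₁ := 2) rfl ((hA _ _ 2 (by lia)).elim _ _)
  obtain ⟨E, i, π, t, w', h₁, h₂, h₃⟩ := exists_shortExact_map_of_ext hS₁ _ e he
  exact ⟨E, i, π, t, w', h₁, h₂.trans (by simp), h₃⟩

end Lifting

/-! ### Formality of complexes over a hereditary category -/

section ZeroDifferential

variable {A : Type u} [Category.{v} A]

/-- The cochain complex with zero differentials and prescribed terms. -/
abbrev zeroDiff [HasZeroMorphisms A] (M : ℤ → A) : CochainComplex A ℤ where
  X := M
  d _ _ := 0

/-- The morphism of complexes with zero differentials with prescribed components. -/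
@[simps]
def zeroDiffMap [HasZeroMorphisms A] {M N : ℤ → A} (f : ∀ n, M n ⟶ N n) :
    zeroDiff M ⟶ zeroDiff N where
  f := f

variable [Abelian A]

/-- The homology of a complex with zero differentials. -/
noncomputable def zeroDiffHomologyIso (M : ℤ → A) (n : ℤ) : (zeroDiff M).homology n ≅ M n :=
  ((zeroDiff M).isoHomologyι n (n + 1) (by simp) rfl) ≪≫
      ((zeroDiff M).pOpcyclesIso (n - 1) n (by simp) rfl).symm

@[simp]
lemma homologyπ_zeroDiffHomologyIso_hom (M : ℤ → A) (n : ℤ) :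
    (zeroDiff M).homologyπ n ≫ (zeroDiffHomologyIso M n).hom = (zeroDiff M).iCycles n := by
  simp [zeroDiffHomologyIso]

lemma homologyMap_from_zeroDiff {M : ℤ → A} {K : CochainComplex A ℤ} (α : zeroDiff M ⟶ K)
    {n : ℤ} (t : M n ⟶ K.cycles n) (ht : t ≫ K.iCycles n = α.f n) :
    HomologicalComplex.homologyMap α n =
      (zeroDiffHomologyIso M n).hom ≫ t ≫ K.homologyπ n := by
  rw [← cancel_epi ((zeroDiff M).homologyπ n), reassoc_of% homologyπ_zeroDiffHomologyIso_hom M n,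
    HomologicalComplex.homologyπ_naturality, ← Category.assoc]
  congr 1
  rw [← cancel_mono (K.iCycles n), HomologicalComplex.cyclesMap_i, ← ht, Category.assoc]

lemma zeroDiffHomologyIso_hom_naturality {M N : ℤ → A} (f : ∀ n, M n ⟶ N n) (n : ℤ) :
    HomologicalComplex.homologyMap (zeroDiffMap f) n ≫ (zeroDiffHomologyIso N n).hom =
      (zeroDiffHomologyIso M n).hom ≫ f n := by
  rw [← cancel_epi ((zeroDiff M).homologyπ n), reassoc_of% homologyπ_zeroDiffHomologyIso_hom M n,
    HomologicalComplex.homologyπ_naturality_assoc, homologyπ_zeroDiffHomologyIso_hom,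
    HomologicalComplex.cyclesMap_i]
  rfl

lemma zeroDiff_shortExact {M N P : ℤ → A} (f : ∀ n, M n ⟶ N n) (g : ∀ n, N n ⟶ P n)
    (w : ∀ n, f n ≫ g n = 0) (h : ∀ n, (ShortComplex.mk (f n) (g n) (w n)).ShortExact) :
    (ShortComplex.mk (zeroDiffMap f) (zeroDiffMap g) (by ext n; exact w n)).ShortExact :=
  HomologicalComplex.shortExact_of_degreewise_shortExact _ h

variable [HasDerivedCategory.{w} A]

/-- The homology in the derived category of a cochain complex. -/
noncomputable def homologyQIso (K : CochainComplex A ℤ) (n : ℤ) :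
    (DerivedCategory.homologyFunctor A n).obj (DerivedCategory.Q.obj K) ≅ K.homology n :=
  (DerivedCategory.homologyFunctorFactors A n).app K

@[simp]
lemma homologyQIso_hom_naturality {K L : CochainComplex A ℤ} (f : K ⟶ L) (n : ℤ) :
    (DerivedCategory.homologyFunctor A n).map (DerivedCategory.Q.map f) ≫
      (homologyQIso L n).hom = (homologyQIso K n).hom ≫ HomologicalComplex.homologyMap f n :=
  DerivedCategory.homologyFunctorFactors_hom_naturality f n

/-- The homology of a complex with zero differentials, in the derived category. -/
noncomputable def homologyQZeroDiffIso (M : ℤ → A) (n : ℤ) :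
    (DerivedCategory.homologyFunctor A n).obj (DerivedCategory.Q.obj (zeroDiff M)) ≅ M n :=
  homologyQIso (zeroDiff M) n ≪≫ zeroDiffHomologyIso M n

lemma homologyQZeroDiffIso_hom_naturality {M N : ℤ → A} (f : ∀ n, M n ⟶ N n) (n : ℤ) :
    (DerivedCategory.homologyFunctor A n).map (DerivedCategory.Q.map (zeroDiffMap f)) ≫
      (homologyQZeroDiffIso N n).hom = (homologyQZeroDiffIso M n).hom ≫ f n := by
  simp [homologyQZeroDiffIso, reassoc_of% homologyQIso_hom_naturality (zeroDiffMap f) n,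
    zeroDiffHomologyIso_hom_naturality]

lemma exists_zeroDiff_distinguished {M N P : ℤ → A} (f : ∀ n, M n ⟶ N n)
    (g : ∀ n, N n ⟶ P n) (w : ∀ n, f n ≫ g n = 0)
    (h : ∀ n, (ShortComplex.mk (f n) (g n) (w n)).ShortExact) :
    ∃ δ, Triangle.mk (DerivedCategory.Q.map (zeroDiffMap f))
      (DerivedCategory.Q.map (zeroDiffMap g)) δ ∈ distTriang (DerivedCategory A) :=
  ⟨_, DerivedCategory.triangleOfSES_distinguished (zeroDiff_shortExact f g w h)⟩

/-- With zero differentials everywhere, `i` and `π` give a triangle, and `t` gives a chain map `α`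
from `E` to `K`. As `i ≫ α` is null-homotopic, `α` factors in `D(A)` through the cohomology of `K`.
All degrees are treated at once, so no infinite products or coproducts are needed. -/
lemma nonempty_iso_zeroDiff_of_lift (K : CochainComplex A ℤ) (E : ℤ → A)
    (i : ∀ n, K.X (n - 1) ⟶ E n) (π : ∀ n, E n ⟶ K.homology n) (t : ∀ n, E n ⟶ K.cycles n)
    (w : ∀ n, i n ≫ π n = 0) (h : ∀ n, (ShortComplex.mk (i n) (π n) (w n)).ShortExact)
    (hi : ∀ n, i n ≫ t n = K.toCycles (n - 1) n) (ht : ∀ n, t n ≫ K.homologyπ n = π n) :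
    Nonempty (DerivedCategory.Q.obj (zeroDiff (fun n ↦ K.homology n)) ≅
      DerivedCategory.Q.obj K) := by
  let α : zeroDiff E ⟶ K :=
    { f := fun n ↦ t n ≫ K.iCycles n
      comm' := fun p q _ ↦ by rw [Category.assoc, K.iCycles_d, comp_zero, zero_comp] }
  -- In degree `n` this composite is the differential `K.X (n - 1) ⟶ K.X n`, so the identities of
  -- the `K.X (n - 1)` form the homotopy.
  have hα : Homotopy (zeroDiffMap i ≫ α) 0 :=
    { hom := fun p q ↦ if hpq : p - 1 = q then eqToHom (by subst hpq; rfl) else 0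
      zero := fun p q hpq ↦ dif_neg (fun h ↦ hpq (by simp [← h]))
      comm := fun n ↦ by
        rw [dNext_eq _ (show (ComplexShape.up ℤ).Rel n (n + 1) by simp),
          prevD_eq _ (show (ComplexShape.up ℤ).Rel (n - 1) n by simp)]
        simp [α, reassoc_of% hi] }
  obtain ⟨δ, hT⟩ := exists_zeroDiff_distinguished i π w h
  obtain ⟨ψ, hψ⟩ : ∃ ψ : DerivedCategory.Q.obj (zeroDiff (fun n ↦ K.homology n)) ⟶
      DerivedCategory.Q.obj K, DerivedCategory.Q.map α =
        DerivedCategory.Q.map (zeroDiffMap π) ≫ ψ :=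
    Triangle.yoneda_exact₂ _ hT (DerivedCategory.Q.map α)
      ((DerivedCategory.Q.map_comp _ _).symm.trans
        ((DerivedCategory.Q_map_eq_of_homotopy _ hα).trans (DerivedCategory.Q.map_zero _ _)))
  have : IsIso ψ := by
    rw [DerivedCategory.isIso_iff]
    intro n
    have : Epi (π n) := (h n).epi_g
    have nat := homologyQZeroDiffIso_hom_naturality π n
    have : Epi ((DerivedCategory.homologyFunctor A n).map
        (DerivedCategory.Q.map (zeroDiffMap π))) := by
      rw [← Iso.eq_comp_inv] at nat
      rw [nat]
      infer_instance
    -- Both `α` and `π` induce `π n` on cohomology, so cancelling this epimorphism shows that `ψ`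
    -- induces the identity of `K.homology n`, up to the canonical identifications.
    have key : (DerivedCategory.homologyFunctor A n).map ψ =
        (homologyQZeroDiffIso (fun n ↦ K.homology n) n).hom ≫
          (homologyQIso K n).inv := by
      rw [← cancel_epi ((DerivedCategory.homologyFunctor A n).map
          (DerivedCategory.Q.map (zeroDiffMap π))),
        ← cancel_mono ((homologyQIso K n).hom),
        ← Functor.map_comp, ← hψ, homologyQIso_hom_naturality,
        homologyMap_from_zeroDiff α (t n) rfl, Category.assoc,
        Category.assoc, Iso.inv_hom_id, Category.comp_id, nat, ht]
      simp [homologyQZeroDiffIso]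
    rw [key]
    infer_instance
  exact ⟨asIso ψ⟩

lemma IsHereditary.nonempty_iso_zeroDiff [HasExt.{w'} A] (hA : IsHereditary.{w'} A)
    (K : DerivedCategory A) :
    Nonempty (DerivedCategory.Q.obj
      (zeroDiff (fun n ↦ (DerivedCategory.homologyFunctor A n).obj K)) ≅ K) := by
  let K₀ := DerivedCategory.Q.objPreimage K
  let e := DerivedCategory.Q.objObjPreimageIso K
  have lift (n : ℤ) := hA.exists_extension (K₀.toCycles (n - 1) n) (K₀.homologyπ n) (by simp)
    (ShortComplex.exact_of_g_is_cokernel _ (K₀.homologyIsCokernel (n - 1) n (by simp)))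
  choose E i π t w h hi ht using lift
  obtain ⟨e'⟩ := nonempty_iso_zeroDiff_of_lift K₀ E i π t w h hi ht
  let f (n : ℤ) : (DerivedCategory.homologyFunctor A n).obj K ≅ K₀.homology n :=
    (DerivedCategory.homologyFunctor A n).mapIso e.symm ≪≫
      homologyQIso K₀ n
  have : ∀ n, IsIso ((zeroDiffMap (fun n ↦ (f n).hom)).f n) := fun n ↦
    inferInstanceAs (IsIso (f n).hom)
  have : IsIso (zeroDiffMap (fun n ↦ (f n).hom)) :=
    HomologicalComplex.Hom.isIso_of_components _
  exact ⟨DerivedCategory.Q.mapIso (asIso (zeroDiffMap (fun n ↦ (f n).hom))) ≪≫ e' ≪≫ e⟩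

end ZeroDifferential

/-! ### Ext-orthogonal subcategories -/

section Perp

open scoped ZeroObject

variable {A : Type u} [Category.{v} A] [Abelian A] [HasExt.{w'} A]

lemma ExtVanish.hom_eq_zero {M N : A} (h : ExtVanish.{w'} M N) (f : M ⟶ N) : f = 0 :=
  Abelian.Ext.mk₀_eq_zero_iff f |>.1 ((h 0).elim _ _)

lemma ExtVanish.exists_section {S : ShortComplex A} (hS : S.ShortExact)
    (h : ExtVanish.{w'} S.X₃ S.X₁) : ∃ s : S.X₃ ⟶ S.X₂, s ≫ S.g = 𝟙 _ := by
  obtain ⟨x, hx⟩ := Abelian.Ext.covariant_sequence_exact₃ S.X₃ hS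
    (Abelian.Ext.mk₀.{w'} (𝟙 S.X₃)) (zero_add 1) ((h 1).elim _ _)
  obtain ⟨s, rfl⟩ := (Abelian.Ext.mk₀_bijective _ _).2 x
  rw [Abelian.Ext.mk₀_comp_mk₀] at hx
  exact ⟨s, (Abelian.Ext.mk₀_bijective _ _).1 hx⟩

lemma extVanish_of_isZero_left {M : A} (hM : IsZero M) (N : A) : ExtVanish.{w'} M N :=
  fun n ↦ ⟨fun a b ↦ by
    rw [← Abelian.Ext.mk₀_id_comp a, ← Abelian.Ext.mk₀_id_comp b, hM.eq_of_src (𝟙 M) 0]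
    simp⟩

lemma extVanish_of_isZero_right (M : A) {N : A} (hN : IsZero N) : ExtVanish.{w'} M N :=
  fun n ↦ ⟨fun a b ↦ by
    rw [← Abelian.Ext.comp_mk₀_id a, ← Abelian.Ext.comp_mk₀_id b, hN.eq_of_src (𝟙 N) 0]
    simp⟩

lemma ExtVanish.of_iso {M M' N N' : A} (h : ExtVanish.{w'} M N) (e : M ≅ M') (e' : N ≅ N') :
    ExtVanish.{w'} M' N' :=
  fun n ↦ ⟨fun a b ↦ by
    have key (x : Abelian.Ext.{w'} M' N' n) : x = (Abelian.Ext.mk₀ e.inv).comp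
        (((Abelian.Ext.mk₀ e.hom).comp x (zero_add n)).comp (Abelian.Ext.mk₀ e'.inv)
          (add_zero n) |>.comp (Abelian.Ext.mk₀ e'.hom) (add_zero n)) (zero_add n) := by
      simp
    rw [key a, key b]
    congr 2
    exact (h n).elim _ _⟩

instance (C : ObjectProperty A) : (rightPerp.{w'} C).IsClosedUnderIsomorphisms where
  of_iso e h M hM := (h M hM).of_iso (Iso.refl M) e

instance (C : ObjectProperty A) : (leftPerp.{w'} C).IsClosedUnderIsomorphisms where
  of_iso e h N hN := (h N hN).of_iso e (Iso.refl N)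

instance (C : ObjectProperty A) : (rightPerp.{w'} C).ContainsZero where
  exists_zero := ⟨0, isZero_zero A, fun M _ ↦ extVanish_of_isZero_right M (isZero_zero A)⟩

instance (C : ObjectProperty A) : (leftPerp.{w'} C).ContainsZero where
  exists_zero := ⟨0, isZero_zero A, fun N _ ↦ extVanish_of_isZero_left (isZero_zero A) N⟩

end Perp

/-! ### Orthogonality in the derived category through cohomology -/

section DerivedOf

variable {A : Type u} [Category.{v} A] [Abelian A] [HasDerivedCategory.{w} A]

/-- The homology of a shifted object. -/
noncomputable def homologyShiftIso (K : DerivedCategory A) (a n m : ℤ) (h : a + n = m) :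
    (DerivedCategory.homologyFunctor A n).obj (K⟦a⟧) ≅
      (DerivedCategory.homologyFunctor A m).obj K :=
  ((DerivedCategory.homologyFunctor A 0).shiftIso a n m h).app K

variable (X : ObjectProperty A)

instance [X.IsClosedUnderIsomorphisms] : (derivedOf X).IsClosedUnderIsomorphisms where
  of_iso e h n := X.prop_of_iso ((DerivedCategory.homologyFunctor A n).mapIso e) (h n)

instance [X.IsClosedUnderIsomorphisms] : (derivedOf X).IsStableUnderShift ℤ where
  isStableUnderShiftBy a :=
    { le_shift := fun K hK n ↦ X.prop_of_iso (homologyShiftIso K a n _ rfl).symm (hK _) }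

variable {X}

lemma derivedOf_zeroDiff [X.IsClosedUnderIsomorphisms] {M : ℤ → A} (hM : ∀ n, X (M n)) :
    derivedOf X (DerivedCategory.Q.obj (zeroDiff M)) :=
  fun n ↦ X.prop_of_iso (homologyQZeroDiffIso M n).symm (hM n)

lemma derivedOf_single [X.IsClosedUnderIsomorphisms] [X.ContainsZero] {M : A} (hM : X M) :
    derivedOf X ((DerivedCategory.singleFunctor A 0).obj M) := by
  intro n
  obtain h | rfl | h := lt_trichotomy n 0
  · exact X.prop_of_isZero (DerivedCategory.isZero_of_isGE
      ((DerivedCategory.singleFunctor A 0).obj M) 0 n h)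
  · exact X.prop_of_iso (homologySingleIso M).symm hM
  · exact X.prop_of_isZero (DerivedCategory.isZero_of_isLE
      ((DerivedCategory.singleFunctor A 0).obj M) 0 n h)

variable [HasExt.{w'} A] (hA : IsHereditary.{w'} A)

include hA

lemma IsHereditary.exists_hom_of_homology (K : DerivedCategory A) {M : ℤ → A}
    (f : ∀ n, M n ⟶ (DerivedCategory.homologyFunctor A n).obj K) :
    ∃ φ : DerivedCategory.Q.obj (zeroDiff M) ⟶ K, ∀ n,
      (DerivedCategory.homologyFunctor A n).map φ = (homologyQZeroDiffIso M n).hom ≫ f n := by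
  obtain ⟨e⟩ := hA.nonempty_iso_zeroDiff K
  let a (n : ℤ) := (homologyQZeroDiffIso
    (fun n ↦ (DerivedCategory.homologyFunctor A n).obj K) n).symm ≪≫
      (DerivedCategory.homologyFunctor A n).mapIso e
  refine ⟨DerivedCategory.Q.map (zeroDiffMap (fun n ↦ f n ≫ (a n).inv)) ≫ e.hom, fun n ↦ ?_⟩
  have nat := homologyQZeroDiffIso_hom_naturality (fun n ↦ f n ≫ (a n).inv) n
  rw [← Iso.eq_comp_inv] at nat
  rw [Functor.map_comp, nat]
  simp [a, ← Functor.map_comp]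

lemma IsHereditary.nonempty_retract (K : DerivedCategory A) (n : ℤ) :
    Nonempty (Retract ((DerivedCategory.singleFunctor A 0).obj
      ((DerivedCategory.homologyFunctor A n).obj K)) (K⟦n⟧)) := by
  obtain ⟨e⟩ := hA.nonempty_iso_zeroDiff K
  let M (n : ℤ) := (DerivedCategory.homologyFunctor A n).obj K
  let i : (HomologicalComplex.single A (ComplexShape.up ℤ) n).obj (M n) ⟶ zeroDiff M :=
    HomologicalComplex.mkHomFromSingle (𝟙 (M n)) (fun _ _ ↦ by simp)
  let r : zeroDiff M ⟶ (HomologicalComplex.single A (ComplexShape.up ℤ) n).obj (M n) :=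
    HomologicalComplex.mkHomToSingle (𝟙 (M n)) (fun _ _ ↦ by simp)
  let ρ₀ : Retract ((HomologicalComplex.single A (ComplexShape.up ℤ) n).obj (M n))
      (zeroDiff M) :=
    { i := i
      r := r
      retract := by
        apply HomologicalComplex.from_single_hom_ext
        simp [i, r] }
  let ρ : Retract ((DerivedCategory.singleFunctor A n).obj (M n)) K :=
    (ρ₀.map DerivedCategory.Q).trans (Retract.ofIso e)
  exact ⟨(Retract.ofIso (((DerivedCategory.singleFunctors A).shiftIso n 0 n
    (add_zero n)).app (M n)).symm).trans (ρ.map (shiftFunctor _ n))⟩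

/-- `Ext^m(M, H^n K)` is a direct summand of `Hom(M, K[n][m])`, which vanishes. -/
lemma IsHereditary.rightPerp_homology [X.IsClosedUnderIsomorphisms] [X.ContainsZero]
    {K : DerivedCategory A} (hK : (derivedOf X).rightOrthogonal K) (n : ℤ) :
    rightPerp.{w'} X ((DerivedCategory.homologyFunctor A n).obj K) := by
  obtain ⟨ρ⟩ := hA.nonempty_retract K n
  intro M hM m
  have hz (x : Abelian.Ext.{w'} M ((DerivedCategory.homologyFunctor A n).obj K) m) : x = 0 := by
    apply Abelian.Ext.ext
    have h₁ : (derivedOf X).rightOrthogonal (K⟦n⟧) := ObjectProperty.le_shift _ n _ hK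
    have h₂ : (derivedOf X).rightOrthogonal (K⟦n⟧⟦(m : ℤ)⟧) :=
      ObjectProperty.le_shift _ (m : ℤ) _ h₁
    have h := h₂ (x.hom ≫ ρ.i⟦(m : ℤ)⟧') (derivedOf_single hM)
    rw [← Category.comp_id x.hom, ← CategoryTheory.Functor.map_id, ← ρ.retract, Functor.map_comp,
      reassoc_of% h]
    simp
  exact ⟨fun a b ↦ (hz a).trans (hz b).symm⟩

lemma IsHereditary.leftPerp_homology [X.IsClosedUnderIsomorphisms] [X.ContainsZero]
    {K : DerivedCategory A} (hK : (derivedOf X).leftOrthogonal K) (n : ℤ) :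
    leftPerp.{w'} X ((DerivedCategory.homologyFunctor A n).obj K) := by
  obtain ⟨ρ⟩ := hA.nonempty_retract K n
  intro N hN m
  have hz (x : Abelian.Ext.{w'} ((DerivedCategory.homologyFunctor A n).obj K) N m) : x = 0 := by
    apply Abelian.Ext.ext
    have h₁ : (derivedOf X).leftOrthogonal (K⟦n⟧) := ObjectProperty.le_shift _ n _ hK
    have h := h₁ (ρ.r ≫ x.hom) (ObjectProperty.le_shift _ (m : ℤ) _ (derivedOf_single hN))
    rw [← Category.id_comp x.hom, ← ρ.retract, Category.assoc, h]
    simp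
  exact ⟨fun a b ↦ (hz a).trans (hz b).symm⟩

/-- Vanishing of `Hom` makes `f` zero on cohomology, so the cohomology of the cone `C` is an
extension in each degree. Vanishing of `Ext^1` splits these extensions, and formality turns the
splittings into a section of `C ⟶ K[1]` up to isomorphism, which forces `f[1] = 0`. -/
lemma IsHereditary.hom_eq_zero_of_extVanish {Y : ObjectProperty A}
    [X.IsClosedUnderIsomorphisms] [Y.IsClosedUnderIsomorphisms]
    (hXY : ∀ M N, X M → Y N → ExtVanish.{w'} M N) {K L : DerivedCategory A}
    (hK : derivedOf X K) (hL : derivedOf Y L) (f : K ⟶ L) : f = 0 := by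
  obtain ⟨C, g, h, hT⟩ := distinguished_cocone_triangle f
  have hK' := ObjectProperty.le_shift _ (1 : ℤ) _ hK
  have hL' := ObjectProperty.le_shift _ (1 : ℤ) _ hL
  have hrot := rot_of_distTriang _ hT
  have hses (n : ℤ) : (ShortComplex.mk ((DerivedCategory.homologyFunctor A n).map g)
      ((DerivedCategory.homologyFunctor A n).map h)
      (by rw [← Functor.map_comp, show g ≫ h = 0 from comp_distTriang_mor_zero₂₃ _ hT,
        Functor.map_zero])).ShortExact :=
    { exact := DerivedCategory.HomologySequence.exact₂ _ hrot n
      mono_f := (DerivedCategory.HomologySequence.mono_homologyMap_mor₂_iff _ hT n).2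
        ((hXY _ _ (hK n) (hL n)).hom_eq_zero _)
      epi_g := (DerivedCategory.HomologySequence.epi_homologyMap_mor₁_iff _
        (rot_of_distTriang _ hrot) n).2 ((hXY _ _ (hK' n) (hL' n)).hom_eq_zero _) }
  choose s hs using fun n ↦ (hXY _ _ (hK' n) (hL n)).exists_section (hses n)
  obtain ⟨σ, hσ⟩ := hA.exists_hom_of_homology C s
  have : IsIso (σ ≫ h) := by
    rw [DerivedCategory.isIso_iff]
    intro n
    rw [Functor.map_comp, hσ, Category.assoc]
    have := hs n
    dsimp at this
    rw [this]
    infer_instance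
  have hf : h ≫ f⟦(1 : ℤ)⟧' = 0 := comp_distTriang_mor_zero₃₁ _ hT
  apply (shiftFunctor (DerivedCategory A) (1 : ℤ)).map_injective
  rw [← cancel_epi (σ ≫ h), Category.assoc, hf]
  simp

end DerivedOf

/-! ### Splitting the five-term sequence -/

section FiveTerm

variable {A : Type u} [Category.{v} A] [Abelian A]

lemma shortExact_kernel_factorThruImage {Y₁ X₁ M : A} (a : Y₁ ⟶ X₁) (b : X₁ ⟶ M)
    (hab : a ≫ b = 0) [Mono a] (h : (ShortComplex.mk a b hab).Exact) :
    (ShortComplex.mk a (factorThruImage b)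
      (by rw [← cancel_mono (image.ι b)]; simp [hab])).ShortExact where
  mono_f := inferInstanceAs (Mono a)
  epi_g := inferInstanceAs (Epi (factorThruImage b))
  exact := by
    rw [ShortComplex.exact_iff_exact_up_to_refinements] at h ⊢
    intro T x hx
    dsimp at x hx
    exact h x (by simpa using hx =≫ image.ι b)

/-- `E` replaces `M` so that the map to `Y₂` becomes surjective without changing its kernel, the
image of `b`. -/
lemma shortExact_image_extension {X₁ M Y₂ X₂ E : A} (b : X₁ ⟶ M) (c : M ⟶ Y₂) (d : Y₂ ⟶ X₂)
    (hbc : b ≫ c = 0) (hcd : c ≫ d = 0) (hM : (ShortComplex.mk b c hbc).Exact)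
    (hY : (ShortComplex.mk c d hcd).Exact) (i : M ⟶ E) (π : E ⟶ X₂) (t : E ⟶ Y₂)
    (w : i ≫ π = 0) (hE : (ShortComplex.mk i π w).ShortExact) (hit : i ≫ t = c)
    (htd : t ≫ d = π) :
    (ShortComplex.mk (image.ι b ≫ i) t
      (by rw [← cancel_epi (factorThruImage b)]; simp [hit, hbc])).ShortExact where
  mono_f := by
    have : Mono i := hE.mono_f
    exact inferInstanceAs (Mono (image.ι b ≫ i))
  epi_g := by
    have : Epi π := hE.epi_g
    change Epi t
    rw [epi_iff_surjective_up_to_refinements]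
    intro T y
    obtain ⟨T₁, p₁, _, x, hx⟩ := surjective_up_to_refinements_of_epi π (y ≫ d)
    rw [ShortComplex.exact_iff_exact_up_to_refinements] at hY
    obtain ⟨T₂, p₂, _, z, hz⟩ := hY (p₁ ≫ y - x ≫ t) (by simp [hx, htd])
    refine ⟨T₂, p₂ ≫ p₁, inferInstance, z ≫ i + p₂ ≫ x, ?_⟩
    dsimp at hz
    simp [hit, ← hz]
  exact := by
    have hE' := hE.exact
    rw [ShortComplex.exact_iff_exact_up_to_refinements] at hM hE' ⊢
    intro T x hx
    dsimp at x hx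
    obtain ⟨T₁, p₁, _, y, hy⟩ := hE' x (by simpa [htd] using hx =≫ d)
    dsimp at y hy
    obtain ⟨T₂, p₂, _, z, hz⟩ := hM y (by
      have : y ≫ c = 0 := by simpa [hx, hit] using (hy =≫ t).symm
      exact this)
    dsimp at z hz
    refine ⟨T₂, p₂ ≫ p₁, inferInstance, z ≫ factorThruImage b, ?_⟩
    dsimp
    rw [Category.assoc, Category.assoc, image.fac_assoc, hy, reassoc_of% hz]

lemma HasApproximationSequence.of_iso {X Y : ObjectProperty A} {M M' : A}
    (h : HasApproximationSequence X Y M) (e : M ≅ M') : HasApproximationSequence X Y M' := by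
  obtain ⟨Y₁, X₁, Y₂, X₂, a, b, c, d, hab, hbc, hcd, hX₁, hX₂, hY₁, hY₂, ha, ex₁, ex₂, ex₃,
    hd⟩ := h
  refine ⟨Y₁, X₁, Y₂, X₂, a, b ≫ e.hom, e.inv ≫ c, d, by simp [reassoc_of% hab], by simp [hbc],
    by simp [hcd], hX₁, hX₂, hY₁, hY₂, ha, ?_, ?_, ?_, hd⟩
  · exact ShortComplex.exact_of_iso
      (ShortComplex.isoMk (S₁ := ShortComplex.mk _ _ hab) (Iso.refl _) (Iso.refl _) e
        (by simp) (by simp)) ex₁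
  · exact ShortComplex.exact_of_iso
      (ShortComplex.isoMk (S₁ := ShortComplex.mk _ _ hbc) (Iso.refl _) e (Iso.refl _)
        (by simp) (by simp)) ex₂
  · exact ShortComplex.exact_of_iso
      (ShortComplex.isoMk (S₁ := ShortComplex.mk _ _ hcd) e (Iso.refl _) (Iso.refl _)
        (by simp) (by simp)) ex₃

end FiveTerm

/-! ### Formal properties of Ext-orthogonal pairs -/

section Orthogonal

variable {A : Type u} [Category.{v} A] [Abelian A] [HasExt.{w'} A] {X Y : ObjectProperty A}

lemma IsExtOrthogonalPair.extVanish (h : IsExtOrthogonalPair.{w'} X Y) {M N : A}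
    (hM : X M) (hN : Y N) : ExtVanish.{w'} M N := by
  obtain ⟨rfl, _⟩ := h
  exact hN M hM

lemma IsExtOrthogonalPair.isClosedUnderIsomorphisms_left (h : IsExtOrthogonalPair.{w'} X Y) :
    X.IsClosedUnderIsomorphisms := by
  rw [h.left_eq]
  infer_instance

lemma IsExtOrthogonalPair.isClosedUnderIsomorphisms_right (h : IsExtOrthogonalPair.{w'} X Y) :
    Y.IsClosedUnderIsomorphisms := by
  rw [← h.right_eq]
  infer_instance

lemma IsExtOrthogonalPair.containsZero_right (h : IsExtOrthogonalPair.{w'} X Y) :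
    Y.ContainsZero := by
  rw [← h.right_eq]
  infer_instance

end Orthogonal

/-! ### From five-term sequences to triangles and back -/

section Hereditary

variable {A : Type u} [Category.{v} A] [Abelian A] [HasExt.{w'} A] [HasDerivedCategory.{w} A]
  {X Y : ObjectProperty A} (hA : IsHereditary.{w'} A)

include hA

lemma IsExtOrthogonalPair.derivedOf_le_rightOrthogonal (h : IsExtOrthogonalPair.{w'} X Y) :
    derivedOf Y ≤ (derivedOf X).rightOrthogonal := by
  have := h.isClosedUnderIsomorphisms_right
  have := h.isClosedUnderIsomorphisms_left
  exact fun L hL K f hK ↦ hA.hom_eq_zero_of_extVanish (fun M N ↦ h.extVanish) hK hL f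

lemma IsExtOrthogonalPair.derivedOf_eq_leftOrthogonal (h : IsExtOrthogonalPair.{w'} X Y) :
    derivedOf X = (derivedOf Y).leftOrthogonal := by
  have := h.isClosedUnderIsomorphisms_right
  have := h.containsZero_right
  refine le_antisymm (fun K hK L f hL ↦ h.derivedOf_le_rightOrthogonal hA L hL f hK)
    (fun K hK n ↦ ?_)
  rw [h.left_eq]
  exact hA.leftPerp_homology hK n

lemma IsExtOrthogonalPair.isTriangulated_derivedOf (h : IsExtOrthogonalPair.{w'} X Y) :
    (derivedOf X).IsTriangulated := by
  have := h.isClosedUnderIsomorphisms_right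
  rw [h.derivedOf_eq_leftOrthogonal hA]
  infer_instance

/-- In the chain `X₁ → im b → E ← M`, the first two maps have cones in `D_Y`, so the cone `L` of `X₁
→ E` is right orthogonal to `D_X`. The cone of `M → E` and the fibre of `E → L` lie in `D_X`, hence
`M → E → L` is the required map. -/
lemma IsCompleteExtOrthogonalPair.exists_trW_zeroDiff
    (h : IsCompleteExtOrthogonalPair.{w'} X Y) (M : ℤ → A) :
    ∃ (L : DerivedCategory A) (g : DerivedCategory.Q.obj (zeroDiff M) ⟶ L),
      (derivedOf X).trW g ∧ (derivedOf X).rightOrthogonal L := by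
  have hpair := h.toIsExtOrthogonalPair
  have := hpair.isClosedUnderIsomorphisms_right
  have := hpair.isClosedUnderIsomorphisms_left
  have := hpair.isTriangulated_derivedOf hA
  choose Y₁ X₁ Y₂ X₂ a b c d hab hbc hcd hX₁ hX₂ hY₁ hY₂ _ ex₁ ex₂ ex₃ _ using
    fun n ↦ h.complete (M n)
  choose E i π t w hE hit htd using fun n ↦
    hA.exists_extension (c n) (d n) (hcd n) (ex₃ n)
  obtain ⟨δ₁, hT₁⟩ := exists_zeroDiff_distinguished a (fun n ↦ factorThruImage (b n)) _
    (fun n ↦ shortExact_kernel_factorThruImage (a n) (b n) (hab n) (ex₁ n))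
  obtain ⟨δ₂, hT₂⟩ := exists_zeroDiff_distinguished (fun n ↦ image.ι (b n) ≫ i n) t _
    (fun n ↦ shortExact_image_extension (b n) (c n) (d n) (hbc n) (hcd n) (ex₂ n) (ex₃ n)
      (i n) (π n) (t n) (w n) (hE n) (hit n) (htd n))
  obtain ⟨δ₃, hT₃⟩ := exists_zeroDiff_distinguished i π w hE
  have hφ := MorphismProperty.comp_mem (derivedOf X).rightOrthogonal.trW _ _
    (ObjectProperty.trW.mk' _ hT₁ (hpair.derivedOf_le_rightOrthogonal hA _
      (derivedOf_zeroDiff hY₁)))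
    (ObjectProperty.trW.mk _ hT₂ (hpair.derivedOf_le_rightOrthogonal hA _
      (derivedOf_zeroDiff hY₂)))
  obtain ⟨L, g, δ, hT, hL⟩ := hφ
  exact ⟨L, DerivedCategory.Q.map (zeroDiffMap i) ≫ g, MorphismProperty.comp_mem _ _ _
    (ObjectProperty.trW.mk _ hT₃ (derivedOf_zeroDiff hX₂))
    (ObjectProperty.trW.mk' _ hT (derivedOf_zeroDiff hX₁)), hL⟩

lemma IsCompleteExtOrthogonalPair.hasLocalizationTriangles
    (h : IsCompleteExtOrthogonalPair.{w'} X Y) :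
    HasLocalizationTriangles (derivedOf X) := by
  have := h.toIsExtOrthogonalPair.isTriangulated_derivedOf hA
  intro K
  obtain ⟨e⟩ := hA.nonempty_iso_zeroDiff K
  obtain ⟨L, g, hg, hL⟩ := h.exists_trW_zeroDiff hA
    (fun n ↦ (DerivedCategory.homologyFunctor A n).obj K)
  have hg' : (derivedOf X).trW (e.inv ≫ g) :=
    (MorphismProperty.cancel_left_of_respectsIso _ _ _).2 hg
  rw [ObjectProperty.trW_iff'] at hg'
  obtain ⟨G, f, δ, hT, hG⟩ := hg'
  exact ⟨G, L, f, _, δ, hT, hG, hL⟩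

lemma HasLocalizationTriangles.hasApproximationSequence [X.IsClosedUnderIsomorphisms]
    [X.ContainsZero] (h : HasLocalizationTriangles (derivedOf X)) (M : A) :
    HasApproximationSequence X (rightPerp.{w'} X) M := by
  obtain ⟨G, L, f, g, δ, hT, hG, hL⟩ := h ((DerivedCategory.singleFunctor A 0).obj M)
  have hneg : IsZero ((DerivedCategory.homologyFunctor A (-1)).obj
      ((DerivedCategory.singleFunctor A 0).obj M)) :=
    DerivedCategory.isZero_of_isGE _ 0 (-1) (by lia)
  have hpos : IsZero ((DerivedCategory.homologyFunctor A 1).obj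
      ((DerivedCategory.singleFunctor A 0).obj M)) :=
    DerivedCategory.isZero_of_isLE _ 0 1 (by lia)
  refine HasApproximationSequence.of_iso ?_ (homologySingleIso M)
  exact ⟨_, _, _, _, _, _, _, _, DerivedCategory.HomologySequence.δ_comp _ hT (-1) 0,
    (Functor.map_comp _ _ _).symm.trans
      ((congrArg _ (comp_distTriang_mor_zero₁₂ _ hT)).trans (Functor.map_zero _ _ _)),
    DerivedCategory.HomologySequence.comp_δ _ hT 0 1, hG 0, hG 1,
    hA.rightPerp_homology hL _, hA.rightPerp_homology hL _,
    (DerivedCategory.HomologySequence.exact₃ _ hT (-1) 0).mono_g (hneg.eq_of_src _ _),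
    DerivedCategory.HomologySequence.exact₁ _ hT (-1) 0,
    DerivedCategory.HomologySequence.exact₂ _ hT 0,
    DerivedCategory.HomologySequence.exact₃ _ hT 0 1,
    (DerivedCategory.HomologySequence.exact₁ _ hT 0 1).epi_f (hpos.eq_of_tgt _ _)⟩

/-- The map from `M` to its local part `L` vanishes, so `M` is a retract of `G`. -/
lemma HasLocalizationTriangles.prop_of_leftPerp [X.IsClosedUnderIsomorphisms]
    [X.ContainsZero] [(derivedOf X).IsStableUnderRetracts]
    (h : HasLocalizationTriangles (derivedOf X)) {M : A}
    (hM : leftPerp.{w'} (rightPerp.{w'} X) M) : X M := by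
  obtain ⟨G, L, f, g, δ, hT, hG, hL⟩ := h ((DerivedCategory.singleFunctor A 0).obj M)
  have hg : g = 0 := hA.hom_eq_zero_of_extVanish (X := leftPerp.{w'} (rightPerp.{w'} X))
    (Y := rightPerp.{w'} X) (fun P N hP hN ↦ hP N hN) (derivedOf_single hM)
    (fun n ↦ hA.rightPerp_homology hL n) g
  obtain ⟨s, hs⟩ := Triangle.coyoneda_exact₂ _ hT (𝟙 _)
    ((Category.id_comp _).trans hg)
  have hretract : derivedOf X ((DerivedCategory.singleFunctor A 0).obj M) :=
    ObjectProperty.prop_of_retract _ { i := s, r := f, retract := hs.symm } hG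
  exact X.prop_of_iso (homologySingleIso M) (hretract 0)

lemma HasLocalizationTriangles.isCompleteExtOrthogonalPair [X.IsClosedUnderIsomorphisms]
    [X.ContainsZero] [(derivedOf X).IsStableUnderRetracts]
    (h : HasLocalizationTriangles (derivedOf X)) :
    IsCompleteExtOrthogonalPair.{w'} X (rightPerp.{w'} X) where
  right_eq := rfl
  left_eq := le_antisymm (fun M hM _ hN ↦ hN M hM) (fun _ hM ↦ h.prop_of_leftPerp hA hM)
  complete := h.hasApproximationSequence hA

end Hereditary

end ExtOrthogonal

theorem proposition2p5 {A : Type u} [Category.{v} A] [Abelian A]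
    [HasExt.{w'} A] [HasDerivedCategory.{w} A]
    (hA : ExtOrthogonal.IsHereditary.{w'} A)
    (X : ObjectProperty A) [X.IsClosedUnderIsomorphisms] :
    (∃ (L : DerivedCategory A ⥤ DerivedCategory A) (_ : L.CommShift ℤ),
        ExtOrthogonal.IsLocalizationFunctor L ∧ L.kernel = ExtOrthogonal.derivedOf X) ↔
      ∃ Y : ObjectProperty A, ExtOrthogonal.IsCompleteExtOrthogonalPair.{w'} X Y := by
  constructor
  · rintro ⟨L, _, hL, hker⟩
    have := hL.1
    have h := hL.hasLocalizationTriangles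
    -- Closure under retracts and a zero object are not assumed of `X`; both come from the kernel.
    have hr : L.kernel.IsStableUnderRetracts := ⟨fun ρ hY ↦ by
      refine (IsZero.iff_id_eq_zero _).2 ?_
      rw [← (ρ.map L).retract, IsZero.eq_of_src hY (ρ.map L).r 0, comp_zero]⟩
    obtain ⟨Z, hZ⟩ := HasZeroObject.zero (C := DerivedCategory A)
    have hz : L.kernel Z := L.map_isZero hZ
    rw [hker] at h hr hz
    have : X.ContainsZero :=
      ⟨_, (DerivedCategory.homologyFunctor A 0).map_isZero hZ, hz 0⟩
    exact ⟨_, h.isCompleteExtOrthogonalPair hA⟩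
  · rintro ⟨Y, hXY⟩
    have := hXY.toIsExtOrthogonalPair.isTriangulated_derivedOf hA
    exact (hXY.hasLocalizationTriangles hA).exists_localizationFunctor
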